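/- An instance $I$ of the unreliable job scheduling problem consists of $m\ge 1$ identical parallel machines and finitely many jobs; job $j$ has a success probability $\pi_j\in(0,1)$ and a reward $r_j\ge 0$. A schedule $S$ assigns every job to exactly one machine and orders the jobs on each machine. The expected reward of a sequence of jobs $j_1,\dots,j_K$ on one machine is $\sum_{k=1}^{K}\pi_{j_1}\cdots\pi_{j_k}\,r_{j_k}$, and the expected reward $ER[S]$ is the sum of these values over all machines. A schedule is optimal if it maximizes $ER$. The Z-ratio of job $j$ is $Z_j=\pi_j r_j/(1-\pi_j)$. A Largest-Z-ratio-First (LZF) schedule is obtained by listing the jobs in an order of non-increasing $Z_j$ and assigning them in this order, each one appended to the sequence of a machine for which the product of the success probabilities of the jobs already assigned to it is currently maximum (an empty product is $1$; ties, both in the order and in the choice of the machine, are broken arbitrarily). **Theorem.** The function $f(x,p)=\dfrac{x-p}{x-p^{x}}$ attains a minimum $c$ over all real $x\ge 1$ and $p\in(0,1)$, with $0.8531955<c<0.853196$ (so $c=0.853195\ldots$, which is $0.853196$ rounded to six decimals). For every instance, an optimal schedule $S_{OPT}$ exists, and every LZF schedule $S_{LZF}$ satisfies $$ER[S_{LZF}]\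 \ge\ c\cdot ER[S_{OPT}].$$ -/

import Mathlib

/-- An instance of the unreliable job scheduling problem: `n` jobs, `m ≥ 1` identical parallel
machines, success probabilities strictly between `0` and `1`, and nonnegative rewards. -/
structure UJPInstance where
  n : ℕ
  m : ℕ
  m_pos : 0 < m
  prob : Fin n → ℝ
  reward : Fin n → ℝ
  prob_pos : ∀ j, 0 < prob j
  prob_lt_one : ∀ j, prob j < 1
  reward_nonneg : ∀ j, 0 ≤ reward j

namespace UJPInstance

/-- The Z-ratio `π_j r_j / (1 - π_j)` of job `j`. -/
noncomputable def zRatio (I : UJPInstance) (j : Fin I.n) : ℝ :=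
  I.prob j * I.reward j / (1 - I.prob j)

/-- The cumulative probability of a sequence of jobs: the product of its success probabilities. -/
noncomputable def cumProb (I : UJPInstance) (l : List (Fin I.n)) : ℝ :=
  (l.map I.prob).prod

/-- The expected reward of a sequence of jobs on one machine: each job's reward is multiplied
by the product of the success probabilities of all jobs up to and including it. -/
noncomputable def seqReward (I : UJPInstance) (l : List (Fin I.n)) : ℝ :=
  ∑ k : Fin l.length, I.cumProb (l.take (k.val + 1)) * I.reward (l.get k)

/-- A feasible solution: a sequence of jobs for every machine, such that every job occurs exactly
once overall. -/
structure Schedule (I : UJPInstance) where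
  seq : Fin I.m → List (Fin I.n)
  count_eq_one : ∀ j, ∑ h, (seq h).count j = 1

/-- The total expected reward of a schedule. -/
noncomputable def Schedule.expectedReward {I : UJPInstance} (S : I.Schedule) : ℝ :=
  ∑ h, I.seqReward (S.seq h)

/-- A schedule that maximizes the total expected reward. -/
def Schedule.IsOptimal {I : UJPInstance} (S : I.Schedule) : Prop :=
  ∀ T : I.Schedule, T.expectedReward ≤ S.expectedReward

/-- `I.GreedyRun l s` means: assigning the jobs of the list `l` one after the other, each one
appended to some machine that currently has maximum cumulative probability (ties broken
arbitrarily), can produce the machine sequences `s`. -/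
inductive GreedyRun (I : UJPInstance) :
    List (Fin I.n) → (Fin I.m → List (Fin I.n)) → Prop
  | nil : GreedyRun I [] (fun _ => [])
  | snoc (l : List (Fin I.n)) (s : Fin I.m → List (Fin I.n)) (j : Fin I.n) (h : Fin I.m)
      (run : GreedyRun I l s) (hmax : ∀ h', I.cumProb (s h') ≤ I.cumProb (s h)) :
      GreedyRun I (l ++ [j]) (Function.update s h (s h ++ [j]))

/-- A Largest-Z-ratio-First schedule: a possible result of the greedy assignment for some listing
of all jobs, without repetition, in an order of non-increasing Z-ratio. -/
def Schedule.IsLZF {I : UJPInstance} (S : I.Schedule) : Prop :=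
  ∃ order : List (Fin I.n), order.Nodup ∧ (∀ j, j ∈ order) ∧
    order.Pairwise (fun i j => I.zRatio j ≤ I.zRatio i) ∧ I.GreedyRun order S.seq

end UJPInstance

/-! Appending job j to a machine raises its reward by `Z_j` times the drop in cumulative
probability. Along an order of non-increasing Z, Abel summation (`greedy_reward_bound`) reduces the
claim to prefixes: greedy's total failure probability is at least c times that of any assignment of
the same jobs (`sum_one_sub_cumProb_le`). The competitor may be sorted by Z on each machine
(`seqReward_le_of_perm`).

With sizes -log π, a machine of load L fails with probability 1 - exp(-L), and greedy always picks a
least loaded machine. If y is the final minimum load, each greedy machine is a load l ≤ y followed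
by a last job of size a with l + a ≥ y. No assignment beats keeping these last jobs and melting the
others into fluid poured up to a level w; `levelProfit` shows this by Lagrangian duality with price
exp(-w). `exists_machine_bound` compares machine by machine, with a multiplier that cancels in the
sum. Chords of exp leave conditions on y and w only; the critical one, for p = exp(-y) and x = w/y,
is (x - p)/(x - p^x) ≥ c. -/

/-! ### Minimization of the ratio -/

/-- The function governing the sign of the derivative in the one-dimensional minimization. -/
noncomputable def hump (t : ℝ) : ℝ := t * (1 - t) * Real.exp (-t)

theorem hasDerivAt_hump (t : ℝ) :
    HasDerivAt hump ((1 - 3 * t + t ^ 2) * Real.exp (-t)) t := by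
  have h1 : HasDerivAt (fun t : ℝ => Real.exp (-t)) (Real.exp (-t) * -1) t :=
    (hasDerivAt_neg t).exp
  have h2 : HasDerivAt (fun t : ℝ => t * (1 - t)) (1 * (1 - t) + t * (-1)) t :=
    (hasDerivAt_id' t).mul ((hasDerivAt_id' t).const_sub 1)
  refine (h2.mul h1).congr_deriv ?_
  ring

theorem concaveOn_hump : ConcaveOn ℝ (Set.Icc 0 1) hump := by
  have hd : deriv hump = fun t => (1 - 3 * t + t ^ 2) * Real.exp (-t) :=
    funext fun t => (hasDerivAt_hump t).deriv
  have hd2 : ∀ t : ℝ, HasDerivAt (fun t : ℝ => (1 - 3 * t + t ^ 2) * Real.exp (-t))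
      (-((1 - t) * (4 - t)) * Real.exp (-t)) t := by
    intro t
    have h1 : HasDerivAt (fun t : ℝ => Real.exp (-t)) (Real.exp (-t) * -1) t :=
      (hasDerivAt_neg t).exp
    have h2 : HasDerivAt (fun t : ℝ => 1 - 3 * t + t ^ 2) (-(3 * 1) + 2 * t) t := by
      refine ((((hasDerivAt_id' t).const_mul 3).const_sub 1).add
        ((hasDerivAt_id' t).pow 2)).congr_deriv ?_
      norm_num
    refine (h2.mul h1).congr_deriv ?_
    ring
  refine concaveOn_of_deriv2_nonpos (convex_Icc 0 1)
    (fun t _ => (hasDerivAt_hump t).continuousAt.continuousWithinAt)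
    (fun t _ => (hasDerivAt_hump t).differentiableAt.differentiableWithinAt) ?_ ?_
  · rw [hd]
    exact fun t _ => (hd2 t).differentiableAt.differentiableWithinAt
  · intro t ht
    rw [interior_Icc] at ht
    simp only [Function.iterate_succ, Function.iterate_zero, Function.comp, id]
    rw [hd, (hd2 t).deriv]
    have : 0 ≤ (1 - t) * (4 - t) := mul_nonneg (by linarith [ht.2]) (by linarith [ht.2])
    nlinarith [Real.exp_pos (-t)]

/-- Superlevel sets of a concave function are intervals, so the peak of `hump` need not be located.
-/
theorem min_hump_le {s t u : ℝ} (hs : 0 ≤ s) (hst : s ≤ t) (htu : t ≤ u) (hu : u ≤ 1) :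
    min (hump s) (hump u) ≤ hump t :=
  concaveOn_hump.min_le_of_mem_Icc ⟨hs, by linarith⟩ ⟨by linarith, hu⟩ ⟨hst, htu⟩

theorem lt_hump_half : 0.147 < hump (1 / 2) := by
  unfold hump
  have h1 : (0.6 : ℝ) < Real.exp (-(1 / 2)) := by
    have h2 : Real.exp (-(1 / 2)) * Real.exp (-(1 / 2)) = Real.exp (-1) := by
      rw [← Real.exp_add]; norm_num
    nlinarith [Real.exp_neg_one_gt_d9, Real.exp_pos (-(1 / 2))]
  linarith

/-- The profile in `y` left after minimizing
`a * w - y * exp (-y) + (1 - a) * y * exp (-w)` over `w`; it has its minimum `0` at `u`. -/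
theorem log_profile_nonneg {a u : ℝ} (hu : 1 / 2 < u) (hu1 : u < 1) (ha : hump u = a)
    (ha0 : 0 < a) (ha1 : a < 0.147) (hE : Real.log ((1 - a) * u / a) = u / (1 - u))
    {y : ℝ} (hy : a / (1 - a) ≤ y) :
    0 ≤ a * (1 + Real.log ((1 - a) * y / a)) - y * Real.exp (-y) := by
  set f : ℝ → ℝ := fun y => a * (1 + Real.log ((1 - a) * y / a)) - y * Real.exp (-y) with hf
  have hb : 0 < 1 - a := by linarith
  have hlow : 0 < a / (1 - a) := by positivity
  have hder : ∀ y, 0 < y → HasDerivAt f ((a - hump y) / y) y := by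
    intro y hy
    have h1 : HasDerivAt (fun t : ℝ => Real.exp (-t)) (Real.exp (-y) * -1) y :=
      (hasDerivAt_neg y).exp
    have h2 : HasDerivAt (fun t : ℝ => (1 - a) * t / a) ((1 - a) * 1 / a) y :=
      ((hasDerivAt_id' y).const_mul (1 - a)).div_const a
    have h3 := ((h2.log (by positivity)).const_add 1).const_mul a
    have h4 := h3.sub ((hasDerivAt_id' y).mul h1)
    refine h4.congr_deriv ?_
    unfold hump
    field_simp
    ring
  have hmono : ∀ s t, 0 < s → s ≤ t → (∀ v, s ≤ v → v ≤ t → hump v ≤ a) → f s ≤ f t := by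
    intro s t hs hst h
    refine monotoneOn_of_deriv_nonneg (convex_Icc s t)
      (fun v hv => (hder v (by linarith [hv.1])).continuousAt.continuousWithinAt)
      (fun v hv => ?_) (fun v hv => ?_) ⟨le_rfl, hst⟩ ⟨hst, le_rfl⟩ hst
    · rw [interior_Icc] at hv
      exact (hder v (by linarith [hv.1])).differentiableAt.differentiableWithinAt
    · rw [interior_Icc] at hv
      rw [(hder v (by linarith [hv.1])).deriv]
      exact div_nonneg (by linarith [h v hv.1.le hv.2.le]) (by linarith [hv.1])
  have hanti : ∀ s t, 0 < s → s ≤ t → (∀ v, s ≤ v → v ≤ t → a ≤ hump v) → f t ≤ f s := by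
    intro s t hs hst h
    refine antitoneOn_of_deriv_nonpos (convex_Icc s t)
      (fun v hv => (hder v (by linarith [hv.1])).continuousAt.continuousWithinAt)
      (fun v hv => ?_) (fun v hv => ?_) ⟨le_rfl, hst⟩ ⟨hst, le_rfl⟩ hst
    · rw [interior_Icc] at hv
      exact (hder v (by linarith [hv.1])).differentiableAt.differentiableWithinAt
    · rw [interior_Icc] at hv
      rw [(hder v (by linarith [hv.1])).deriv]
      exact div_nonpos_of_nonpos_of_nonneg (by linarith [h v hv.1.le hv.2.le]) (by linarith [hv.1])
  have hfu : f u = 0 := by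
    simp only [hf]
    rw [hE, ← ha]
    unfold hump
    have : 1 - u ≠ 0 := by linarith
    field_simp
    ring
  have hf0 : 0 ≤ f (a / (1 - a)) := by
    simp only [hf]
    have h1 : (1 - a) * (a / (1 - a)) / a = 1 := by field_simp
    rw [h1, Real.log_one]
    have h2 : a / (1 - a) * Real.exp (-(a / (1 - a))) ≤ a := by
      rw [div_mul_eq_mul_div, div_le_iff₀ hb]
      refine mul_le_mul_of_nonneg_left ?_ ha0.le
      rw [Real.exp_neg, inv_le_comm₀ (Real.exp_pos _) hb]
      have := Real.add_one_le_exp (a / (1 - a))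
      have h3 : a / (1 - a) + 1 = (1 - a)⁻¹ := by field_simp; ring
      linarith
    linarith
  have hhalf : a < hump (1 / 2) := by linarith [lt_hump_half]
  change 0 ≤ f y
  have hy0 : 0 < y := by linarith
  -- The sign of a - `hump` makes f increase, then decrease to its zero at u, then increase again;
  -- only the left end and u can be minima.
  rcases le_total y u with hyu | hyu
  · by_cases hk : a ≤ hump y
    · rw [← hfu]
      refine hanti y u hy0 hyu fun v h1 h2 => ?_
      have := min_hump_le hy0.le h1 h2 hu1.le
      rw [ha, min_eq_right hk] at this
      exact this
    · push Not at hk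
      refine hf0.trans (hmono _ y hlow hy fun v h1 h2 => ?_)
      by_contra! hv
      have := min_hump_le (by linarith) h2 hyu hu1.le
      rw [ha, min_eq_right hv.le] at this
      linarith
  · rw [← hfu]
    refine hmono u y (by linarith) hyu fun v h1 h2 => ?_
    by_contra! hv
    have hv1 : v ≤ 1 := by
      by_contra! hv1
      have : hump v ≤ 0 := by
        unfold hump
        exact mul_nonpos_of_nonpos_of_nonneg (by nlinarith) (Real.exp_pos _).le
      linarith
    -- As `hump` exceeds a at 1/2, exceeding it again at v would force `hump u` > a.
    have := min_hump_le (by norm_num) hu.le h1 hv1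
    rw [ha] at this
    exact absurd this (not_le.2 (lt_min hhalf hv))

/-- The expression is convex in w with critical point log((1 - a)y/a). If that is nonnegative, the
tangent of exp there leaves the profile above. Otherwise the expression increases for w ≥ y, and the
tangent at w = y suffices. -/
theorem ratio_bound_exp {a u : ℝ} (hu : 1 / 2 < u) (hu1 : u < 1) (ha : hump u = a)
    (ha0 : 0 < a) (ha1 : a < 0.147) (hE : Real.log ((1 - a) * u / a) = u / (1 - u))
    {y w : ℝ} (hy : 0 < y) (hw : y ≤ w) :
    0 ≤ a * w - y * Real.exp (-y) + (1 - a) * y * Real.exp (-w) := by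
  have hb : 0 < 1 - a := by linarith
  rcases le_total (a / (1 - a)) y with h | h
  · have h1 := log_profile_nonneg hu hu1 ha ha0 ha1 hE h
    have h2 := Real.add_one_le_exp (Real.log ((1 - a) * y / a) - w)
    rw [sub_eq_add_neg, Real.exp_add, Real.exp_log (by positivity)] at h2
    have h3 := mul_le_mul_of_nonneg_left h2 ha0.le
    have h4 : a * ((1 - a) * y / a * Real.exp (-w)) = (1 - a) * y * Real.exp (-w) := by
      field_simp
    rw [h4] at h3
    linarith
  · rw [le_div_iff₀ hb] at h
    have h1 := Real.add_one_le_exp (y - w)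
    have h2 : Real.exp (-w) = Real.exp (-y) * Real.exp (y - w) := by
      rw [← Real.exp_add]; ring_nf
    have h3 : Real.exp (-y) * (1 + (y - w)) ≤ Real.exp (-w) := by
      rw [h2]; exact mul_le_mul_of_nonneg_left (by linarith) (Real.exp_pos _).le
    have h4 := mul_le_mul_of_nonneg_left h3 (mul_nonneg hb.le hy.le)
    have he := Real.exp_pos (-y)
    have he1 : Real.exp (-y) ≤ 1 := Real.exp_le_one_iff.2 (by linarith)
    have h5 : 0 ≤ (a - y * (1 - a)) * ((w - y) * Real.exp (-y)) :=
      mul_nonneg (by linarith) (mul_nonneg (by linarith) he.le)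
    have h6 : 0 ≤ a * w * (1 - Real.exp (-y)) :=
      mul_nonneg (mul_nonneg ha0.le (by linarith)) (by linarith)
    nlinarith

theorem abs_exp_sub_sum_range_le {x : ℝ} (h0 : 0 ≤ x) (h1 : x ≤ 1) :
    |Real.exp x - ∑ m ∈ Finset.range 14, x ^ m / m.factorial| ≤ 1e-10 := by
  have := Real.exp_bound (x := x) (by rw [abs_of_nonneg h0]; exact h1) (n := 14) (by norm_num)
  refine this.trans ?_
  have h2 : |x| ^ 14 ≤ 1 := pow_le_one₀ (abs_nonneg _) (by rw [abs_of_nonneg h0]; exact h1)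
  calc _ ≤ 1 * (((14 : ℕ).succ : ℝ) / ((14 : ℕ).factorial * (14 : ℕ))) :=
        mul_le_mul_of_nonneg_right h2 (by positivity)
    _ ≤ 1e-10 := by norm_num [Nat.factorial]

/-- The minimum ratio `c`, attained at `p = exp (-y)` and `p ^ x = exp (-w)`. -/
theorem exists_ratio_constant : ∃ c y w : ℝ, 0.8531955 < c ∧ c < 0.853196 ∧ 0 < y ∧ y ≤ w ∧
    (1 - c) * w - y * Real.exp (-y) + c * y * Real.exp (-w) = 0 ∧
    ∀ y w : ℝ, 0 < y → y ≤ w →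
      0 ≤ (1 - c) * w - y * Real.exp (-y) + c * y * Real.exp (-w) := by
  -- For a = `hump t`, t is critical for the profile; the profile vanishes there iff log((1 - a)t/a)
  -- = t/(1 - t), which exponentiates to F t = 0.
  set F : ℝ → ℝ := fun t => (1 - t) * Real.exp (t ^ 2 / (1 - t)) - (1 - hump t) with hF
  have hcont : ContinuousOn F (Set.Icc 0.52899155 0.528993) := by
    intro t ht
    have : 1 - t ≠ 0 := by linarith [ht.2]
    have h2 := (hasDerivAt_hump t).continuousAt
    refine ContinuousAt.continuousWithinAt ?_
    simp only [hF]
    fun_prop (disch := assumption)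
  have num : ∀ t : ℝ, 0 ≤ t → t ≤ 1 → ∀ l r : ℝ,
      l ≤ ∑ m ∈ Finset.range 14, t ^ m / m.factorial - 1e-10 →
      ∑ m ∈ Finset.range 14, t ^ m / m.factorial + 1e-10 ≤ r →
      l ≤ Real.exp t ∧ Real.exp t ≤ r := by
    intro t h0 h1 l r hl hr
    have := abs_le.1 (abs_exp_sub_sum_range_le h0 h1)
    constructor <;> linarith [this.1, this.2]
  have hlo := num 0.52899155 (by norm_num) (by norm_num) 1.697219883 1.697219885
    (by norm_num [Finset.sum_range_succ, Nat.factorial])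
    (by norm_num [Finset.sum_range_succ, Nat.factorial])
  have hhi := num 0.528993 (by norm_num) (by norm_num) 1.697222344 1.697222346
    (by norm_num [Finset.sum_range_succ, Nat.factorial])
    (by norm_num [Finset.sum_range_succ, Nat.factorial])
  have hlo2 := num (0.52899155 ^ 2 / (1 - 0.52899155)) (by norm_num) (by norm_num)
    1.811422794 1.811422796
    (by norm_num [Finset.sum_range_succ, Nat.factorial])
    (by norm_num [Finset.sum_range_succ, Nat.factorial])
  have hhi2 := num (0.528993 ^ 2 / (1 - 0.528993)) (by norm_num) (by norm_num)
    1.811432006 1.811432009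
    (by norm_num [Finset.sum_range_succ, Nat.factorial])
    (by norm_num [Finset.sum_range_succ, Nat.factorial])
  have humplo : hump 0.52899155 < 0.1468045 - 1e-8 := by
    unfold hump
    rw [Real.exp_neg, ← div_eq_mul_inv, div_lt_iff₀ (Real.exp_pos _)]
    linarith [hlo.1]
  have humphi : 0.146804 < hump 0.528993 := by
    unfold hump
    rw [Real.exp_neg, ← div_eq_mul_inv, lt_div_iff₀ (Real.exp_pos _)]
    linarith [hhi.2]
  have humphalf : 0.1468045 < hump (1 / 2) := by linarith [lt_hump_half]
  have hF0 : F 0.52899155 ≤ 0 := by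
    simp only [hF]
    linarith [hlo2.2]
  have hF1 : 0 ≤ F 0.528993 := by
    simp only [hF]
    linarith [hhi2.1]
  obtain ⟨u, ⟨hu0, hu1⟩, hu⟩ := intermediate_value_Icc (by norm_num) hcont ⟨hF0, hF1⟩
  -- Otherwise `hump` would dip between 1/2 and u, at the left end of the bracket.
  have hup : hump u < 0.1468045 := by
    by_contra! h
    have h1 := min_hump_le (s := 1 / 2) (t := 0.52899155) (u := u) (by norm_num) (by norm_num)
      hu0 (by linarith)
    have h2 := le_min humphalf.le h
    linarith
  have hlow : 0.146804 < hump u := by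
    have h1 := min_hump_le (s := 1 / 2) (t := u) (u := 0.528993) (by norm_num) (by linarith)
      hu1 (by norm_num)
    exact (lt_min (by linarith) humphi).trans_le h1
  have hu' : 1 - u ≠ 0 := by linarith
  have hupos : 0 < u := by linarith
  have hratio : (1 - hump u) * u / hump u = Real.exp (u / (1 - u)) := by
    have h1 : 1 - hump u = (1 - u) * Real.exp (u ^ 2 / (1 - u)) := by
      simp only [hF] at hu
      linarith
    have h2 : u / (1 - u) = u ^ 2 / (1 - u) + u := by field_simp; ring
    have h3 : Real.exp (-u) * Real.exp u = 1 := by rw [← Real.exp_add]; simp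
    rw [div_eq_iff (by linarith), h1, h2, Real.exp_add]
    unfold hump
    linear_combination (-(1 - u) * u * Real.exp (u ^ 2 / (1 - u))) * h3
  have hE : Real.log ((1 - hump u) * u / hump u) = u / (1 - u) := by
    rw [hratio, Real.log_exp]
  refine ⟨1 - hump u, u, u / (1 - u), by linarith, by linarith, hupos, ?_, ?_, ?_⟩
  · rw [le_div_iff₀ (by linarith)]
    nlinarith
  · have h1 : (1 - hump u) * u * Real.exp (-(u / (1 - u))) = hump u := by
      rw [Real.exp_neg, ← hratio]
      have : 1 - hump u ≠ 0 := by linarith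
      have : hump u ≠ 0 := by linarith
      field_simp
    rw [h1]
    unfold hump
    field_simp
    ring
  · intro y w hy hw
    have := ratio_bound_exp (a := hump u) (by linarith) (by linarith) rfl (by linarith)
      (by linarith) hE hy hw
    simpa using this

/-- The minimum of `(x - p) / (x - p ^ x)` and its inequality in exponential coordinates. -/
theorem exists_isLeast_ratio : ∃ c : ℝ,
    IsLeast {y : ℝ | ∃ x p : ℝ, 1 ≤ x ∧ 0 < p ∧ p < 1 ∧ y = (x - p) / (x - p ^ x)} c ∧
    0.8531955 < c ∧ c < 0.853196 ∧
    ∀ y w : ℝ, 0 < y → y ≤ w →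
      0 ≤ (1 - c) * w - y * Real.exp (-y) + c * y * Real.exp (-w) := by
  obtain ⟨c, y, w, hc1, hc2, hy, hyw, heq, hall⟩ := exists_ratio_constant
  refine ⟨c, ⟨⟨w / y, Real.exp (-y), ?_, Real.exp_pos _, ?_, ?_⟩, ?_⟩, hc1, hc2, hall⟩
  · rwa [le_div_iff₀ hy, one_mul]
  · exact Real.exp_lt_one_iff.2 (by linarith)
  · have h1 : Real.exp (-y) ^ (w / y) = Real.exp (-w) := by
      rw [← Real.exp_mul]; congr 1; field_simp
    rw [h1]
    have h2 : 1 ≤ w / y := by rwa [le_div_iff₀ hy, one_mul]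
    have h3 : Real.exp (-w) < 1 := Real.exp_lt_one_iff.2 (by linarith)
    rw [eq_div_iff (by linarith)]
    field_simp
    linarith
  · rintro _ ⟨x, p, hx, hp, hp1, rfl⟩
    have hl : 0 < -Real.log p := by linarith [Real.log_neg hp hp1]
    have h1 := hall (-Real.log p) (x * -Real.log p) hl (by nlinarith)
    have h2 : Real.exp (-(x * -Real.log p)) = p ^ x := by
      rw [Real.rpow_def_of_pos hp]; congr 1; ring
    rw [h2, neg_neg, Real.exp_log hp] at h1
    have h3 : p ^ x < 1 := Real.rpow_lt_one hp.le hp1 (by linarith)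
    rw [le_div_iff₀ (by linarith)]
    have h4 : 0 ≤ -Real.log p * ((1 - c) * x - p + c * p ^ x) := by linarith
    have := nonneg_of_mul_nonneg_right h4 hl
    linarith

/-! ### Comparison on a single machine -/

theorem exp_neg_mul_le {t w : ℝ} (h0 : 0 ≤ t) (h1 : t ≤ 1) :
    Real.exp (-(t * w)) ≤ 1 - t + t * Real.exp (-w) := by
  have := convexOn_exp.2 (Set.mem_univ 0) (Set.mem_univ (-w)) (sub_nonneg.2 h1) h0 (by ring)
  simp only [smul_eq_mul, mul_zero, zero_add, Real.exp_zero, mul_one] at this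
  rwa [← mul_neg]

/-- A linear function that is nonnegative at both ends of `[0, 1]` is nonnegative between them. -/
theorem add_mul_nonneg_of_mem_Icc {A B t : ℝ} (h0 : 0 ≤ t) (h1 : t ≤ 1) (hA : 0 ≤ A)
    (hB : 0 ≤ A + B) : 0 ≤ A + t * B := by
  nlinarith [mul_nonneg (sub_nonneg.2 h1) hA, mul_nonneg h0 hB]

/-- The slope of the per-machine comparison, with both endpoint conditions. -/
theorem exists_slope {c : ℝ} (hc0 : 0 < c) (hc1 : c < 1)
    (hc : ∀ y w : ℝ, 0 < y → y ≤ w →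
      0 ≤ (1 - c) * w - y * Real.exp (-y) + c * y * Real.exp (-w))
    {y w : ℝ} (hy : 0 < y) (hw : y ≤ w) :
    ∃ t : ℝ, t ≤ 1 - c ∧ t ≤ 1 - c - Real.exp (-w) * (Real.exp (-y) - c) ∧
      0 ≤ 1 - Real.exp (-y) - c * (1 - Real.exp (-w)) + t * (w / y - 1) := by
  have hp0 := Real.exp_pos (-y)
  have hq0 := Real.exp_pos (-w)
  have hp1 : Real.exp (-y) ≤ 1 := Real.exp_le_one_iff.2 (by linarith)
  have hq1 : Real.exp (-w) ≤ 1 := Real.exp_le_one_iff.2 (by linarith)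
  -- Since w/y ≥ 1, the best t is the smaller of its two upper bounds. In the first case the claim
  -- is `hc` divided by y.
  rcases le_total (Real.exp (-y)) c with hpc | hpc
  · refine ⟨1 - c, le_rfl, by nlinarith, ?_⟩
    have h1 := div_nonneg (hc y w hy hw) hy.le
    have h2 : ((1 - c) * w - y * Real.exp (-y) + c * y * Real.exp (-w)) / y =
        1 - Real.exp (-y) - c * (1 - Real.exp (-w)) + (1 - c) * (w / y - 1) := by
      field_simp; ring
    rwa [h2] at h1
  · refine ⟨1 - c - Real.exp (-w) * (Real.exp (-y) - c), by nlinarith, le_rfl, ?_⟩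
    have hw0 : 0 < w := by linarith
    have hber := exp_neg_mul_le (t := y / w) (w := w) (by positivity)
      (by rwa [div_le_one hw0])
    rw [div_mul_cancel₀ _ hw0.ne'] at hber
    set x := w / y with hx
    have hx1 : 1 ≤ x := by rwa [hx, one_le_div hy]
    have hyx : y / w = 1 / x := by rw [hx]; field_simp
    rw [hyx] at hber
    set p := Real.exp (-y)
    set q := Real.exp (-w)
    have hb : 1 - x * (1 - p) ≤ q := by
      have h1 := mul_le_mul_of_nonneg_left hber (by linarith : 0 ≤ x)
      have h2 : x * (1 - 1 / x + 1 / x * q) = x - 1 + q := by field_simp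
      linarith
    -- The claim is affine in q with slope p - x(p - c), hence worst at an end of [1 - x(1 - p), 1].
    rcases le_total (x * (p - c)) p with hK | hK
    · nlinarith [mul_nonneg (sub_nonneg.2 hK) (sub_nonneg.2 hb),
        mul_nonneg (mul_nonneg (by linarith : 0 ≤ x) (sub_nonneg.2 hp1))
          (add_nonneg (sub_nonneg.2 hp1) (mul_nonneg (by linarith : 0 ≤ x) (sub_nonneg.2 hpc)))]
    · nlinarith [mul_nonneg (sub_nonneg.2 hK) (sub_nonneg.2 hq1),
        mul_nonneg (by linarith : 0 ≤ x) (sub_nonneg.2 hp1)]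

/-- Comparison of one greedy machine, consisting of a load `l` followed by a last job of size `a`,
with the water level `w`, up to a multiple of the amount of water. -/
theorem exists_machine_bound {c : ℝ} (hc0 : 0 < c) (hc1 : c < 1)
    (hc : ∀ y w : ℝ, 0 < y → y ≤ w →
      0 ≤ (1 - c) * w - y * Real.exp (-y) + c * y * Real.exp (-w))
    {y w : ℝ} (hy : 0 < y) (hw : y ≤ w) :
    ∃ T : ℝ, ∀ l a : ℝ, 0 ≤ l → l ≤ y → 0 ≤ a → y ≤ l + a →
      c * (1 - Real.exp (-max a w)) ≤
        1 - Real.exp (-(l + a)) + T * (max (w - a) 0 - l) := by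
  obtain ⟨t, ht1, ht2, ht3⟩ := exists_slope hc0 hc1 hc hy hw
  refine ⟨t / y, fun l a hl0 hly ha hla => ?_⟩
  have hp0 := Real.exp_pos (-y)
  have hq0 := Real.exp_pos (-w)
  rcases le_total w a with hwa | hwa
  · rw [max_eq_left hwa, max_eq_right (by linarith)]
    have h1 := exp_neg_mul_le (t := l / y) (w := y) (by positivity) (by rwa [div_le_one hy])
    rw [div_mul_cancel₀ _ hy.ne'] at h1
    have hA0 := Real.exp_pos (-a)
    have hA1 : Real.exp (-a) ≤ 1 := Real.exp_le_one_iff.2 (by linarith)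
    have hAq : Real.exp (-a) ≤ Real.exp (-w) := Real.exp_le_exp.2 (by linarith)
    have h2 : Real.exp (-(l + a)) = Real.exp (-a) * Real.exp (-l) := by
      rw [← Real.exp_add]; ring_nf
    rw [h2]
    have h3 := mul_le_mul_of_nonneg_left h1 hA0.le
    have h4 : 0 ≤ (1 - c) * (1 - Real.exp (-a)) +
        l / y * (Real.exp (-a) * (1 - Real.exp (-y)) - t) := by
      refine add_mul_nonneg_of_mem_Icc (by positivity) (by rwa [div_le_one hy])
        (mul_nonneg (by linarith) (by linarith)) ?_
      -- The condition t ≤ 1 - c - A(exp(-y) - c) is affine in A = exp(-a), which lies between 0 and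
      -- exp(-w); the bounds on t are these two ends.
      rcases le_total (Real.exp (-y)) c with h | h <;> nlinarith
    have h5 : t / y * (0 - l) = -(l / y * t) := by ring
    rw [h5]
    nlinarith
  · rw [max_eq_right hwa, max_eq_left (by linarith)]
    have hw0 : 0 < w := by linarith
    -- Chord in l + a - y over [0, w]: its ends are the third and the second condition on t.
    have hs0 : 0 ≤ (l + a - y) / w := div_nonneg (by linarith) hw0.le
    have hs1 : (l + a - y) / w ≤ 1 := by rw [div_le_one hw0]; linarith
    have h1 := exp_neg_mul_le (w := w) hs0 hs1
    rw [div_mul_cancel₀ _ hw0.ne'] at h1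
    have h2 : Real.exp (-(l + a)) = Real.exp (-y) * Real.exp (-(l + a - y)) := by
      rw [← Real.exp_add]; ring_nf
    rw [h2]
    have h3 := mul_le_mul_of_nonneg_left h1 hp0.le
    have h4 := add_mul_nonneg_of_mem_Icc
      (B := Real.exp (-y) * (1 - Real.exp (-w)) - t * (w / y)) hs0 hs1 ht3 (by nlinarith)
    have h5 : t / y * (w - a - l) = t * (w / y - 1) - (l + a - y) / w * (t * (w / y)) := by
      field_simp; ring
    rw [h5]
    nlinarith

/-! ### Water level and summation over machines -/

/-- The water level determined by the total amount of fluid. -/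
theorem exists_water_level {ι : Type*} [Fintype ι] [Nonempty ι] (l a : ι → ℝ) {y : ℝ}
    (hl0 : ∀ i, 0 ≤ l i) (ha : ∀ i, 0 ≤ a i) (hla : ∀ i, y ≤ l i + a i) :
    ∃ w, y ≤ w ∧ ∑ i, max (w - a i) 0 = ∑ i, l i := by
  set W := y + ∑ i, l i + ∑ i, a i + |y|
  have hcont : ContinuousOn (fun w => ∑ i, max (w - a i) 0) (Set.Icc y W) := by fun_prop
  have hls : 0 ≤ ∑ i, l i := Finset.sum_nonneg fun i _ => hl0 i
  have has : 0 ≤ ∑ i, a i := Finset.sum_nonneg fun i _ => ha i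
  have hyW : y ≤ W := by
    have := abs_nonneg y
    simp only [W]; linarith
  have hlow : ∑ i, max (y - a i) 0 ≤ ∑ i, l i :=
    Finset.sum_le_sum fun i _ => max_le (by linarith [hla i]) (hl0 i)
  have hhigh : ∑ i, l i ≤ ∑ i, max (W - a i) 0 := by
    obtain ⟨i⟩ := ‹Nonempty ι›
    have h1 := Finset.single_le_sum (f := fun i => max (W - a i) 0)
      (fun i _ => le_max_right _ _) (Finset.mem_univ i)
    refine le_trans (le_trans ?_ (le_max_left _ _)) h1
    have h2 := Finset.single_le_sum (f := a) (fun i _ => ha i) (Finset.mem_univ i)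
    have h3 := neg_abs_le y
    simp only [W]; linarith
  obtain ⟨w, hw, h⟩ := intermediate_value_Icc hyW hcont ⟨hlow, hhigh⟩
  exact ⟨w, hw.1, h⟩

/-- The T-terms cancel because the level w uses up exactly the fluid ∑ l. For y = 0 there is no
fluid and the level is 0. -/
theorem exists_level_bound {ι : Type*} [Fintype ι] [Nonempty ι] {c : ℝ} (hc0 : 0 < c)
    (hc1 : c < 1)
    (hc : ∀ y w : ℝ, 0 < y → y ≤ w →
      0 ≤ (1 - c) * w - y * Real.exp (-y) + c * y * Real.exp (-w))
    (l a : ι → ℝ) {y : ℝ} (hy : 0 ≤ y) (hl0 : ∀ i, 0 ≤ l i) (hly : ∀ i, l i ≤ y)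
    (ha : ∀ i, 0 ≤ a i) (hla : ∀ i, y ≤ l i + a i) :
    ∃ w, 0 ≤ w ∧ ∑ i, max (w - a i) 0 = ∑ i, l i ∧
      c * ∑ i, (1 - Real.exp (-max (a i) w)) ≤ ∑ i, (1 - Real.exp (-(l i + a i))) := by
  rcases hy.eq_or_lt with rfl | hy
  · have hl : ∀ i, l i = 0 := fun i => le_antisymm (hly i) (hl0 i)
    refine ⟨0, le_rfl, by simp [hl, ha], ?_⟩
    rw [Finset.mul_sum]
    refine Finset.sum_le_sum fun i _ => ?_
    rw [hl, zero_add, max_eq_left (ha i)]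
    have : Real.exp (-a i) ≤ 1 := Real.exp_le_one_iff.2 (by linarith [ha i])
    nlinarith
  · obtain ⟨w, hw, hsum⟩ := exists_water_level l a hl0 ha hla
    refine ⟨w, by linarith, hsum, ?_⟩
    obtain ⟨T, hT⟩ := exists_machine_bound hc0 hc1 hc hy hw
    have h1 := Finset.sum_le_sum fun i (_ : i ∈ Finset.univ) =>
      hT (l i) (a i) (hl0 i) (hly i) (ha i) (hla i)
    rw [← Finset.mul_sum, Finset.sum_add_distrib, ← Finset.mul_sum,
      Finset.sum_sub_distrib (f := fun i => max (w - a i) 0), hsum] at h1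
    linarith

/-! ### Lagrangian bound for arbitrary assignments -/

/-- The profit of a machine of load `a` raised to water level `w`, minus the price of the water. -/
noncomputable def levelProfit (w a : ℝ) : ℝ :=
  1 - Real.exp (-max a w) - Real.exp (-w) * max (w - a) 0

theorem exp_neg_tangent (w a : ℝ) : Real.exp (-w) * (1 + (w - a)) ≤ Real.exp (-a) := by
  have h : Real.exp (-a) = Real.exp (-w) * Real.exp (w - a) := by rw [← Real.exp_add]; ring_nf
  rw [h]
  exact mul_le_mul_of_nonneg_left (by linarith [Real.add_one_le_exp (w - a)]) (Real.exp_pos _).le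

theorem levelProfit_of_le {w a : ℝ} (h : a ≤ w) :
    levelProfit w a = 1 - Real.exp (-w) - Real.exp (-w) * (w - a) := by
  rw [levelProfit, max_eq_right h, max_eq_left (by linarith)]

theorem levelProfit_of_ge {w a : ℝ} (h : w ≤ a) : levelProfit w a = 1 - Real.exp (-a) := by
  rw [levelProfit, max_eq_left h, max_eq_right (by linarith), mul_zero, sub_zero]

theorem le_levelProfit (w a : ℝ) : 1 - Real.exp (-a) ≤ levelProfit w a := by
  rcases le_total a w with h | h
  · rw [levelProfit_of_le h]
    linarith [exp_neg_tangent w a]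
  · rw [levelProfit_of_ge h]

/-- A job gains at most its value as fluid, since the profit has slope at most exp(-w). -/
theorem levelProfit_sub_le {w a : ℝ} (hw : 0 ≤ w) :
    levelProfit w a - levelProfit w 0 ≤ Real.exp (-w) * a := by
  rw [levelProfit_of_le hw]
  rcases le_total a w with h | h
  · rw [levelProfit_of_le h]
    linarith
  · rw [levelProfit_of_ge h]
    linarith [exp_neg_tangent w a]

/-- The profit is concave in the load, so increments over an empty machine are subadditive: jobs
sharing a machine gain no more than apart. -/
theorem levelProfit_add_le {w x a : ℝ} (hw : 0 ≤ w) (hx : 0 ≤ x) (ha : 0 ≤ a) :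
    levelProfit w (a + x) ≤ levelProfit w x + (levelProfit w a - levelProfit w 0) := by
  rw [levelProfit_of_le hw]
  have hs := Real.exp_pos (-w)
  have hadd : Real.exp (-(a + x)) = Real.exp (-a) * Real.exp (-x) := by
    rw [← Real.exp_add]; ring_nf
  have ea := Real.exp_pos (-a)
  have ex := Real.exp_pos (-x)
  have ha1 := Real.add_one_le_exp (-a)
  have hx1 := Real.add_one_le_exp (-x)
  have hea : Real.exp (-a) ≤ 1 := Real.exp_le_one_iff.2 (by linarith)
  have hex : Real.exp (-x) ≤ 1 := Real.exp_le_one_iff.2 (by linarith)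
  rcases le_total a w with h1 | h1 <;> rcases le_total x w with h2 | h2
  · rw [levelProfit_of_le h1, levelProfit_of_le h2]
    rcases le_total (a + x) w with h3 | h3
    · rw [levelProfit_of_le h3]; linarith
    · rw [levelProfit_of_ge h3]; linarith [exp_neg_tangent w (a + x)]
  · rw [levelProfit_of_le h1, levelProfit_of_ge h2, levelProfit_of_ge (by linarith), hadd]
    have : Real.exp (-x) ≤ Real.exp (-w) := Real.exp_le_exp.2 (by linarith)
    nlinarith
  · rw [levelProfit_of_ge h1, levelProfit_of_le h2, levelProfit_of_ge (by linarith), hadd]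
    have : Real.exp (-a) ≤ Real.exp (-w) := Real.exp_le_exp.2 (by linarith)
    nlinarith
  · rw [levelProfit_of_ge h1, levelProfit_of_ge h2, levelProfit_of_ge (by linarith), hadd]
    have h3 : Real.exp (-x) ≤ Real.exp (-w) := Real.exp_le_exp.2 (by linarith)
    have h4 : Real.exp (-a) ≤ Real.exp (-w) := Real.exp_le_exp.2 (by linarith)
    have hw1 := Real.add_one_le_exp (-w)
    have hs1 : Real.exp (-w) ≤ 1 := Real.exp_le_one_iff.2 (by linarith)
    nlinarith [mul_nonneg (sub_nonneg.2 h4) (sub_nonneg.2 hex),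
      mul_nonneg (sub_nonneg.2 h3) (sub_nonneg.2 hs1)]

theorem levelProfit_sum_le {α : Type*} {w : ℝ} (hw : 0 ≤ w) (f : α → ℝ) (hf : ∀ j, 0 ≤ f j)
    (t : List α) :
    levelProfit w (t.map f).sum ≤
      levelProfit w 0 + (t.map fun j => levelProfit w (f j) - levelProfit w 0).sum := by
  induction t with
  | nil => simp
  | cons b t ih =>
    have h0 : 0 ≤ (t.map f).sum := List.sum_nonneg (by simpa using fun j _ => hf j)
    simp only [List.map_cons, List.sum_cons]
    linarith [levelProfit_add_le hw h0 (hf b)]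

/-! ### Rewards, Z-ratios and loads -/

namespace UJPInstance

variable {I : UJPInstance}

theorem cumProb_cons (j : Fin I.n) (t : List (Fin I.n)) :
    I.cumProb (j :: t) = I.prob j * I.cumProb t := by
  simp [cumProb]

theorem cumProb_append (t u : List (Fin I.n)) :
    I.cumProb (t ++ u) = I.cumProb t * I.cumProb u := by
  simp [cumProb]

theorem cumProb_singleton (j : Fin I.n) : I.cumProb [j] = I.prob j := by
  simp [cumProb]

theorem cumProb_pos (t : List (Fin I.n)) : 0 < I.cumProb t := by
  refine List.prod_pos fun a ha => ?_
  obtain ⟨j, -, rfl⟩ := List.mem_map.1 ha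
  exact I.prob_pos j

theorem seqReward_nil : I.seqReward [] = 0 := by
  simp [seqReward]

theorem seqReward_cons (j : Fin I.n) (t : List (Fin I.n)) :
    I.seqReward (j :: t) = I.prob j * (I.reward j + I.seqReward t) := by
  unfold seqReward
  refine (Fin.sum_univ_succ (n := t.length) _).trans ?_
  simp only [cumProb, List.take_succ_cons, List.map_cons, List.prod_cons, Fin.val_succ,
    List.get_eq_getElem, List.getElem_cons_succ, Fin.val_zero, List.getElem_cons_zero, zero_add,
    List.take_zero, List.map_nil, List.prod_nil, mul_one, mul_add, Finset.mul_sum, mul_assoc]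

theorem zRatio_mul (j : Fin I.n) : I.zRatio j * (1 - I.prob j) = I.prob j * I.reward j := by
  have : 1 - I.prob j ≠ 0 := by linarith [I.prob_lt_one j]
  rw [zRatio, div_mul_cancel₀ _ this]

theorem zRatio_nonneg (j : Fin I.n) : 0 ≤ I.zRatio j :=
  div_nonneg (mul_nonneg (I.prob_pos j).le (I.reward_nonneg j)) (by linarith [I.prob_lt_one j])

theorem seqReward_append_singleton (t : List (Fin I.n)) (j : Fin I.n) :
    I.seqReward (t ++ [j]) =
      I.seqReward t + I.zRatio j * (I.cumProb t - I.cumProb (t ++ [j])) := by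
  rw [cumProb_append, cumProb_singleton]
  induction t with
  | nil =>
    simp only [List.nil_append, seqReward_cons, seqReward_nil, cumProb, List.map_nil,
      List.prod_nil]
    linarith [zRatio_mul j]
  | cons b t ih =>
    rw [List.cons_append, seqReward_cons, ih, seqReward_cons, cumProb_cons]
    ring

/-- Exchange argument: moving j in front of a neighbour b gains (Z_j - Z_b)(1 - π_b)(1 - π_j), up to
the common prefix factor. -/
theorem seqReward_append_cons_le (t u : List (Fin I.n)) (j : Fin I.n)
    (h : ∀ i ∈ t, I.zRatio i ≤ I.zRatio j) :
    I.seqReward (t ++ j :: u) ≤ I.seqReward (j :: (t ++ u)) := by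
  induction t with
  | nil => exact le_rfl
  | cons b t ih =>
    have h1 := ih fun i hi => h i (List.mem_cons_of_mem _ hi)
    have h2 := h b List.mem_cons_self
    have hb := zRatio_mul b
    have hj := zRatio_mul j
    rw [List.cons_append, seqReward_cons, List.cons_append, seqReward_cons j, seqReward_cons b]
    rw [seqReward_cons j] at h1
    have h3 := mul_le_mul_of_nonneg_left h1 (I.prob_pos b).le
    have h4 := mul_nonneg (sub_nonneg.2 h2)
      (mul_nonneg (sub_nonneg.2 (I.prob_lt_one b).le) (sub_nonneg.2 (I.prob_lt_one j).le))
    have h5 : (I.zRatio j - I.zRatio b) * ((1 - I.prob b) * (1 - I.prob j)) =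
        (1 - I.prob b) * (I.prob j * I.reward j) - (1 - I.prob j) * (I.prob b * I.reward b) := by
      rw [← hb, ← hj]; ring
    rw [h5] at h4
    nlinarith

/-- Ordering the jobs of a machine by non-increasing Z-ratio maximizes its reward. -/
theorem seqReward_le_of_perm {t u : List (Fin I.n)} (hp : t.Perm u)
    (hu : u.Pairwise fun i j => I.zRatio j ≤ I.zRatio i) : I.seqReward t ≤ I.seqReward u := by
  induction u generalizing t with
  | nil => rw [hp.eq_nil]
  | cons b u ih =>
    obtain ⟨t₁, t₂, rfl⟩ := List.append_of_mem (hp.mem_iff.2 List.mem_cons_self)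
    have hp' : (t₁ ++ t₂).Perm u := (List.perm_middle.symm.trans hp).cons_inv
    rw [List.pairwise_cons] at hu
    refine (seqReward_append_cons_le t₁ t₂ b fun i hi =>
      hu.1 i (hp'.mem_iff.1 (List.mem_append_left _ hi))).trans ?_
    rw [seqReward_cons, seqReward_cons]
    exact mul_le_mul_of_nonneg_left (by linarith [ih hp' hu.2]) (I.prob_pos b).le

/-- The size of a job: minus the logarithm of its success probability. -/
noncomputable def size (I : UJPInstance) (j : Fin I.n) : ℝ := -Real.log (I.prob j)

theorem size_nonneg (j : Fin I.n) : 0 ≤ I.size j := by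
  have := Real.log_nonpos (I.prob_pos j).le (I.prob_lt_one j).le
  unfold size; linarith

/-- The load of a sequence of jobs: the sum of their sizes. -/
noncomputable def load (I : UJPInstance) (t : List (Fin I.n)) : ℝ := (t.map I.size).sum

theorem load_nonneg (t : List (Fin I.n)) : 0 ≤ I.load t :=
  List.sum_nonneg (by simpa using fun j _ => size_nonneg j)

theorem cumProb_eq_exp (t : List (Fin I.n)) : I.cumProb t = Real.exp (-I.load t) := by
  induction t with
  | nil => simp [cumProb, load]
  | cons b t ih =>
    have : I.load (b :: t) = I.size b + I.load t := by simp [load]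
    rw [cumProb_cons, ih, this, neg_add, Real.exp_add, size, neg_neg, Real.exp_log (I.prob_pos b)]

theorem cumProb_le_cumProb {t u : List (Fin I.n)} :
    I.cumProb t ≤ I.cumProb u ↔ I.load u ≤ I.load t := by
  rw [cumProb_eq_exp, cumProb_eq_exp, Real.exp_le_exp, neg_le_neg_iff]

/-! ### Failure probability of greedy runs -/

namespace GreedyRun

/-- Before its last job, every machine had at least the probability that any machine has now. -/
theorem cumProb_le_dropLast {l : List (Fin I.n)} {s : Fin I.m → List (Fin I.n)}
    (run : I.GreedyRun l s) (h h' : Fin I.m) : I.cumProb (s h') ≤ I.cumProb (s h).dropLast := by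
  induction run generalizing h h' with
  | nil => simp
  | snoc l s j k run hmax ih =>
    have hle : I.cumProb (Function.update s k (s k ++ [j]) h') ≤ I.cumProb (s h') := by
      rcases eq_or_ne h' k with rfl | hk
      · rw [Function.update_self, cumProb_append, cumProb_singleton]
        exact mul_le_of_le_one_right (cumProb_pos _).le (I.prob_lt_one j).le
      · rw [Function.update_of_ne hk]
    refine hle.trans ?_
    rcases eq_or_ne h k with rfl | hk
    · rw [Function.update_self, List.dropLast_concat]
      exact hmax h'
    · rw [Function.update_of_ne hk]
      exact ih h h'

theorem sum_update {β : Type*} [AddCommMonoid β] (s : Fin I.m → List (Fin I.n)) (k : Fin I.m)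
    (t : List (Fin I.n)) (f : List (Fin I.n) → β) :
    ∑ h, f (Function.update s k t h) + f (s k) = ∑ h, f (s h) + f t := by
  rw [← Finset.add_sum_erase _ _ (Finset.mem_univ k),
    ← Finset.add_sum_erase Finset.univ (fun h => f (s h)) (Finset.mem_univ k),
    Function.update_self, Finset.sum_congr rfl fun h hh => by
      rw [Function.update_of_ne (Finset.ne_of_mem_erase hh)]]
  abel

theorem sum_map {l : List (Fin I.n)} {s : Fin I.m → List (Fin I.n)} (run : I.GreedyRun l s)
    (f : Fin I.n → ℝ) : ∑ h, ((s h).map f).sum = (l.map f).sum := by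
  induction run with
  | nil => simp
  | snoc l s j k run hmax ih =>
    have := sum_update s k (s k ++ [j]) fun t => (t.map f).sum
    simp only [List.map_append, List.sum_append, List.map_cons, List.map_nil, List.sum_cons,
      List.sum_nil, add_zero] at this ⊢
    linarith

/-- The greedy assignment approximates the largest total failure probability of any assignment
of the same jobs. -/
theorem sum_one_sub_cumProb_le {c : ℝ} (hc0 : 0 < c) (hc1 : c < 1)
    (hc : ∀ y w : ℝ, 0 < y → y ≤ w →
      0 ≤ (1 - c) * w - y * Real.exp (-y) + c * y * Real.exp (-w))
    {l : List (Fin I.n)} {s : Fin I.m → List (Fin I.n)} (run : I.GreedyRun l s)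
    (t : Fin I.m → List (Fin I.n))
    (ht : ∀ f : Fin I.n → ℝ, ∑ h, ((t h).map f).sum = (l.map f).sum) :
    c * ∑ h, (1 - I.cumProb (t h)) ≤ ∑ h, (1 - I.cumProb (s h)) := by
  have : Nonempty (Fin I.m) := ⟨⟨0, I.m_pos⟩⟩
  obtain ⟨k, hk⟩ := Finite.exists_min fun h => I.load (s h)
  have hsplit : ∀ h, ∃ a, 0 ≤ a ∧ I.load (s h) = I.load (s h).dropLast + a ∧
      ∀ w, 0 ≤ w → ((s h).map fun j => levelProfit w (I.size j) - levelProfit w 0).sum ≤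
        Real.exp (-w) * I.load (s h).dropLast + (levelProfit w a - levelProfit w 0) := by
    intro h
    rcases List.eq_nil_or_concat (s h) with hs | ⟨u, j, hs⟩
    -- An empty machine counts as having a last job of size 0.
    · exact ⟨0, le_rfl, by simp [hs], fun w _ => by simp [hs, load]⟩
    · rw [List.concat_eq_append] at hs
      refine ⟨I.size j, size_nonneg j, by simp [hs, load], fun w hw => ?_⟩
      rw [hs, List.dropLast_concat, List.map_append, List.sum_append, load,
        ← List.sum_map_mul_left]
      simp only [List.map_cons, List.map_nil, List.sum_cons, List.sum_nil, add_zero]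
      gcongr
      exact List.sum_le_sum fun j _ => levelProfit_sub_le hw
  choose a ha hload hprofit using hsplit
  obtain ⟨w, hw, hsum, hbound⟩ := exists_level_bound hc0 hc1 hc
    (fun h => I.load (s h).dropLast) a (load_nonneg (s k)) (fun h => load_nonneg _)
    (fun h => cumProb_le_cumProb.1 (run.cumProb_le_dropLast h k)) ha
    (fun h => (hload h) ▸ hk h)
  have hgreedy : ∑ h, (1 - Real.exp (-(I.load (s h).dropLast + a h))) =
      ∑ h, (1 - I.cumProb (s h)) :=
    Finset.sum_congr rfl fun h _ => by rw [cumProb_eq_exp, hload]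
  rw [hgreedy] at hbound
  refine le_trans (mul_le_mul_of_nonneg_left ?_ hc0.le) hbound
  -- Bound the competitor by single-job increments, which depend only on the set of jobs and so
  -- transfer to greedy. There all but the last jobs are valued as fluid, and `hsum` cancels the
  -- price terms.
  calc ∑ h, (1 - I.cumProb (t h))
      ≤ ∑ h, (levelProfit w 0 +
          ((t h).map fun j => levelProfit w (I.size j) - levelProfit w 0).sum) :=
        Finset.sum_le_sum fun h _ => by
          rw [cumProb_eq_exp]
          exact (le_levelProfit w _).trans (levelProfit_sum_le hw _ size_nonneg _)
    _ = ∑ h, (levelProfit w 0 +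
          ((s h).map fun j => levelProfit w (I.size j) - levelProfit w 0).sum) := by
        rw [Finset.sum_add_distrib, Finset.sum_add_distrib, ht, run.sum_map]
    _ ≤ ∑ h, (levelProfit w (a h) + Real.exp (-w) * I.load (s h).dropLast) :=
        Finset.sum_le_sum fun h _ => by linarith [hprofit h w hw]
    _ = ∑ h, (1 - Real.exp (-max (a h) w)) := by
        simp only [levelProfit]
        rw [Finset.sum_add_distrib, Finset.sum_sub_distrib
            (f := fun h => 1 - Real.exp (-max (a h) w)), ← Finset.mul_sum, ← Finset.mul_sum, hsum]
        ring

end GreedyRun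

/-! ### From failure probabilities to rewards -/

namespace Schedule

theorem count_eq_ite (T : I.Schedule) (h : Fin I.m) (j : Fin I.n) :
    (T.seq h).count j = if j ∈ T.seq h then 1 else 0 := by
  split_ifs with hj
  · refine le_antisymm ?_ (List.one_le_count_iff.2 hj)
    rw [← T.count_eq_one j]
    exact Finset.single_le_sum (f := fun h => (T.seq h).count j) (fun _ _ => Nat.zero_le _)
      (Finset.mem_univ h)
  · exact List.count_eq_zero.2 hj

theorem nodup_seq (T : I.Schedule) (h : Fin I.m) : (T.seq h).Nodup := by
  rw [List.nodup_iff_count_le_one]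
  intro j
  rw [T.count_eq_ite]
  split_ifs <;> simp

/-- The jobs of `l` that the schedule puts on machine `h`, in the order of `l`. -/
def restrict (T : I.Schedule) (l : List (Fin I.n)) (h : Fin I.m) : List (Fin I.n) :=
  l.filter fun j => decide (j ∈ T.seq h)

theorem restrict_append_singleton (T : I.Schedule) (l : List (Fin I.n)) (j : Fin I.n)
    (h : Fin I.m) :
    T.restrict (l ++ [j]) h = T.restrict l h ++ [j] ∨
      T.restrict (l ++ [j]) h = T.restrict l h := by
  unfold restrict
  by_cases hj : j ∈ T.seq h <;> simp [List.filter_append, hj]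

theorem sum_map_restrict (T : I.Schedule) (l : List (Fin I.n)) (f : Fin I.n → ℝ) :
    ∑ h, ((T.restrict l h).map f).sum = (l.map f).sum := by
  induction l with
  | nil => simp [restrict]
  | cons j l ih =>
    have hstep : ∀ h, ((T.restrict (j :: l) h).map f).sum =
        ((T.seq h).count j : ℝ) * f j + ((T.restrict l h).map f).sum := by
      intro h
      rw [T.count_eq_ite]
      by_cases hj : j ∈ T.seq h <;> simp [restrict, hj]
    simp only [hstep]
    rw [Finset.sum_add_distrib, ih, ← Finset.sum_mul, ← Nat.cast_sum, T.count_eq_one]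
    simp

theorem seqReward_le_restrict (T : I.Schedule) {l : List (Fin I.n)} (hnd : l.Nodup)
    (hall : ∀ j, j ∈ l) (hl : l.Pairwise fun i j => I.zRatio j ≤ I.zRatio i) (h : Fin I.m) :
    I.seqReward (T.seq h) ≤ I.seqReward (T.restrict l h) := by
  refine seqReward_le_of_perm ?_ (hl.filter _)
  unfold restrict
  rw [List.perm_ext_iff_of_nodup (T.nodup_seq h) (hnd.filter _)]
  intro j
  simp [hall]

/-- Abel summation along a greedy run over jobs of non-increasing Z-ratio. -/
theorem greedy_reward_bound {c : ℝ} (T : I.Schedule)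
    (hcore : ∀ l s, I.GreedyRun l s →
      c * ∑ h, (1 - I.cumProb (T.restrict l h)) ≤ ∑ h, (1 - I.cumProb (s h)))
    {l : List (Fin I.n)} {s : Fin I.m → List (Fin I.n)} (run : I.GreedyRun l s)
    (hl : l.Pairwise fun i j => I.zRatio j ≤ I.zRatio i)
    {z : ℝ} (hz : ∀ j ∈ l, z ≤ I.zRatio j) :
    z * (∑ h, (1 - I.cumProb (s h)) - c * ∑ h, (1 - I.cumProb (T.restrict l h))) ≤
      ∑ h, I.seqReward (s h) - c * ∑ h, I.seqReward (T.restrict l h) := by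
  induction run generalizing z with
  | nil => simp [restrict, seqReward_nil, cumProb]
  | snoc l s j k run hmax ih =>
    have hD := hcore _ _ (run.snoc l s j k hmax)
    rw [List.pairwise_append] at hl
    -- The induction hypothesis is taken at the threshold Z_j; `hD` then allows lowering Z_j to z.
    have hih := ih hl.1 fun i hi => hl.2.2 i hi j (by simp)
    have hzj : z ≤ I.zRatio j := hz j (by simp)
    have hT : ∑ h, I.seqReward (T.restrict (l ++ [j]) h) = ∑ h, I.seqReward (T.restrict l h) +
        I.zRatio j * (∑ h, (1 - I.cumProb (T.restrict (l ++ [j]) h)) -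
          ∑ h, (1 - I.cumProb (T.restrict l h))) := by
      rw [← Finset.sum_sub_distrib, Finset.mul_sum, ← Finset.sum_add_distrib]
      refine Finset.sum_congr rfl fun h _ => ?_
      rcases T.restrict_append_singleton l j h with h1 | h1 <;> rw [h1]
      · rw [seqReward_append_singleton]; ring
      · ring
    have hS1 := GreedyRun.sum_update s k (s k ++ [j]) I.seqReward
    have hS2 := GreedyRun.sum_update s k (s k ++ [j]) fun t => 1 - I.cumProb t
    rw [seqReward_append_singleton] at hS1
    rw [hT]
    set D' := ∑ h, (1 - I.cumProb (Function.update s k (s k ++ [j]) h))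
    set U' := ∑ h, (1 - I.cumProb (T.restrict (l ++ [j]) h))
    have h1 := mul_le_mul_of_nonneg_right hzj (sub_nonneg.2 hD)
    have h2 : ∑ h, I.seqReward (Function.update s k (s k ++ [j]) h) =
        ∑ h, I.seqReward (s h) + I.zRatio j * (D' - ∑ h, (1 - I.cumProb (s h))) := by
      have : I.cumProb (s k) - I.cumProb (s k ++ [j]) = D' - ∑ h, (1 - I.cumProb (s h)) := by
        linarith
      rw [← this]
      linarith
    rw [h2]
    linarith

/-- No job repeats on a machine, so list lengths are at most n. -/
theorem finite_schedule (I : UJPInstance) : Finite I.Schedule := by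
  have hfin : Finite {t : List (Fin I.n) // t.length ≤ I.n} :=
    (List.finite_length_le (Fin I.n) I.n).to_subtype
  refine Finite.of_injective
    (fun T : I.Schedule => fun h =>
      (⟨T.seq h, by simpa using (T.nodup_seq h).length_le_card⟩ :
        {t : List (Fin I.n) // t.length ≤ I.n})) ?_
  rintro ⟨s, hs⟩ ⟨t, ht⟩ hst
  congr
  funext h
  exact congrArg Subtype.val (congrFun hst h)

theorem exists_isOptimal (S : I.Schedule) : ∃ T : I.Schedule, T.IsOptimal :=
  have := finite_schedule I
  have : Nonempty I.Schedule := ⟨S⟩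
  Finite.exists_max Schedule.expectedReward

theorem IsLZF.mul_expectedReward_le {c : ℝ} (hc0 : 0 < c) (hc1 : c < 1)
    (hc : ∀ y w : ℝ, 0 < y → y ≤ w →
      0 ≤ (1 - c) * w - y * Real.exp (-y) + c * y * Real.exp (-w))
    {S : I.Schedule} (hS : S.IsLZF) (T : I.Schedule) :
    c * T.expectedReward ≤ S.expectedReward := by
  obtain ⟨l, hnd, hall, hl, run⟩ := hS
  -- The threshold z is 0, so the left side vanishes.
  have h1 := greedy_reward_bound T (c := c)
    (fun l s run => run.sum_one_sub_cumProb_le hc0 hc1 hc _ (T.sum_map_restrict l)) run hl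
    (fun j _ => zRatio_nonneg j)
  have h2 : T.expectedReward ≤ ∑ h, I.seqReward (T.restrict l h) :=
    Finset.sum_le_sum fun h _ => T.seqReward_le_restrict hnd hall hl h
  have h3 := mul_le_mul_of_nonneg_left h2 hc0.le
  unfold expectedReward at h3 ⊢
  linarith

end Schedule

end UJPInstance

theorem theorem1 :
    ∃ c : ℝ,
      IsLeast {y : ℝ | ∃ x p : ℝ, 1 ≤ x ∧ 0 < p ∧ p < 1 ∧ y = (x - p) / (x - p ^ x)} c ∧
      0.8531955 < c ∧ c < 0.853196 ∧
      ∀ (I : UJPInstance) (S : I.Schedule), S.IsLZF →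
        (∃ T : I.Schedule, T.IsOptimal) ∧
        ∀ T : I.Schedule, T.IsOptimal → c * T.expectedReward ≤ S.expectedReward := by
  obtain ⟨c, hleast, hc1, hc2, hc⟩ := exists_isLeast_ratio
  refine ⟨c, hleast, hc1, hc2, fun I S hS => ⟨S.exists_isOptimal, fun T _ => ?_⟩⟩
  exact hS.mul_expectedReward_le (by linarith) (by linarith) hc T
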